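/- Let $f:\mathcal X\times\mathcal Y\to\{0,1\}$ and $\varepsilon\ge 0$. Alice and Bob compute $f$ in parity with error $\varepsilon$ if, for every $(x,y)$, on input $x$ Alice outputs a bit $a$ and on input $y$ Bob outputs a bit $b$ such that $\Pr[a\oplus b=f(x,y)]\ge 1-\varepsilon$. A non-local box takes a bit $p$ from Alice and a bit $q$ from Bob and outputs a bit $a$ to Alice and a bit $b$ to Bob, each pair with $a\oplus b=p\wedge q$ having probability $1/2$. Let $NL^{\mathrm{ord}}_\varepsilon(f)$ be the least $t$ for which $f$ is computed in parity with error $\varepsilon$ by a protocol without communication in which the players share a random string and use $t$ non-local boxes labelled $1,\dots,t$, where the input of each player to box $i$ depends only on that player's input, the shared random string and that player's outputs from boxes $1,\dots,i-1$. A 2-1 oblivious transfer takes bits $p_0,p_1$ from Alice and a bit $q$ from Bob, and outputs $p_q$ to Bob and nothing to Alice. Let $OT_\varepsilon(f)$ be the least number of oblivious transfer calls in a protocol with free two-way communication and private coins that computes $f$ in parity with error $\varepsilon$ over the players' private coins and is perfectly private in the malicious model: for every (possibly randomized) strategy that a player uses in place of the prescribed one, the distribution of this player's view does not depend on the input of the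 other, honest player. (Both quantities are $\infty$ if there is no such protocol; random strings and private coins are discrete, and messages are finite bit strings.) Theorem. For every $f$ and every $\varepsilon\ge 0$, $$OT_\varepsilon(f)\le NL^{\mathrm{ord}}_\varepsilon(f).$$ -/

import Mathlib

namespace SecureEval

/-! ### Ordered non-local box protocols -/

/-- The non-local box: on inputs `p` (Alice) and `q` (Bob) it outputs a uniformly random bit `a`
to Alice and the bit `b = a ⊕ (p ∧ q)` to Bob. -/
noncomputable def nlBox (p q : Bool) : PMF (Bool × Bool) :=
  (PMF.uniformOfFintype Bool).map fun a => (a, xor a (p && q))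

/-- The law of the outputs of a non-local box: probability `1/2` for each pair of bits `(a, b)`
with `a ⊕ b = p ∧ q`, and `0` otherwise. -/
theorem nlBox_apply (p q a b : Bool) :
    nlBox p q (a, b) = if xor a b = (p && q) then 2⁻¹ else 0 := by
  rw [nlBox, PMF.map_apply, tsum_bool]
  cases p <;> cases q <;> cases a <;> cases b <;> simp

/-- A randomized protocol without communication in which Alice (input in `X`) and Bob (input in
`Y`) share a random string and use `boxes` non-local boxes, both in the order `1, 2, …, boxes`.
`inA x s as` is the bit that Alice enters into her next box when her input is `x`, the shared random
string is `s`, and the boxes with smaller labels gave her the outputs `as` (so the label of the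
current box is `as.length + 1`); `outA x s as` is her final output when `as` are the outputs of all
her boxes. The same for Bob. -/
structure OrdNLProtocol (X Y : Type*) where
  boxes : ℕ
  Shared : Type
  law : PMF Shared
  inA : X → Shared → List Bool → Bool
  inB : Y → Shared → List Bool → Bool
  outA : X → Shared → List Bool → Bool
  outB : Y → Shared → List Bool → Bool

namespace OrdNLProtocol

variable {X Y : Type*}

/-- Joint law of the lists of outputs (Alice, Bob) of the first `k` boxes, on inputs `x, y` and
shared random string `s`. -/
noncomputable def boxOutputs (P : OrdNLProtocol X Y) (x : X) (y : Y) (s : P.Shared) :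
    ℕ → PMF (List Bool × List Bool)
  | 0 => PMF.pure ([], [])
  | k + 1 => (boxOutputs P x y s k).bind fun v =>
      (nlBox (P.inA x s v.1) (P.inB y s v.2)).map fun c => (v.1 ++ [c.1], v.2 ++ [c.2])

/-- Law of the exclusive or of the two final outputs on inputs `x, y`. -/
noncomputable def parityLaw (P : OrdNLProtocol X Y) (x : X) (y : Y) : PMF Bool :=
  P.law.bind fun s => (P.boxOutputs x y s P.boxes).map fun v =>
    xor (P.outA x s v.1) (P.outB y s v.2)

/-- On every pair of inputs, the outputs `a, b` satisfy `a ⊕ b = f(x, y)` with probability at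
least `1 - ε`. -/
def ComputesInParity (P : OrdNLProtocol X Y) (f : X → Y → Bool) (ε : ℝ) : Prop :=
  ∀ x y, 1 - ε ≤ (P.parityLaw x y (f x y)).toReal

end OrdNLProtocol

/-- Ordered non-local box complexity of `f` with error `ε` (`⊤` if there is no protocol). -/
noncomputable def ordNLComplexity {X Y : Type*} (f : X → Y → Bool) (ε : ℝ) : ℕ∞ :=
  ⨅ (P : OrdNLProtocol X Y) (_ : P.ComputesInParity f ε), (P.boxes : ℕ∞)

/-! ### Protocols with oblivious transfer and two-way communication -/

/-- 2-1 oblivious transfer: Alice enters `p = (p₀, p₁)`, Bob enters `q` and receives `p_q`; Alice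
receives nothing. -/
def otBox (p : Bool × Bool) (q : Bool) : Bool := if q then p.2 else p.1

/-- A step of a protocol: Alice sends a message to Bob, Bob sends a message to Alice, or they
call one oblivious transfer. -/
inductive Step
  | aliceSends
  | bobSends
  | ot
  deriving DecidableEq

/-- What Alice observes in one step. Messages are finite bit strings. -/
inductive AliceObs
  | nothing
  | message (m : List Bool)

/-- What Bob observes in one step. -/
inductive BobObs
  | nothing
  | message (m : List Bool)
  | otOutput (b : Bool)

/-- A strategy of Alice (for fixed input and fixed coins): the message she sends, or the pair of
bits she enters into the oblivious transfer, as a function of her observations in all previous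
steps. Her earlier actions are determined by these observations. -/
structure AliceStrategy where
  msg : List AliceObs → List Bool
  otIn : List AliceObs → Bool × Bool

/-- A strategy of Bob (for fixed input and fixed coins). -/
structure BobStrategy where
  msg : List BobObs → List Bool
  otIn : List BobObs → Bool

/-- How one step extends the observations of Alice and of Bob. -/
def stepViews (A : AliceStrategy) (B : BobStrategy) (v : List AliceObs × List BobObs) :
    Step → List AliceObs × List BobObs
  | .aliceSends => (v.1 ++ [.nothing], v.2 ++ [.message (A.msg v.1)])
  | .bobSends => (v.1 ++ [.message (B.msg v.2)], v.2 ++ [.nothing])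
  | .ot => (v.1 ++ [.nothing], v.2 ++ [.otOutput (otBox (A.otIn v.1) (B.otIn v.2))])

/-- The observations of Alice and of Bob when the given strategies are run on a schedule. -/
def runViews (schedule : List Step) (A : AliceStrategy) (B : BobStrategy) :
    List AliceObs × List BobObs :=
  schedule.foldl (stepViews A B) ([], [])

/-- A protocol with oblivious transfer and two-way communication, in which Alice and Bob have
independent private coins (and no shared randomness). -/
structure OTProtocol (X Y : Type*) where
  schedule : List Step
  CoinsA : Type
  CoinsB : Type
  lawA : PMF CoinsA
  lawB : PMF CoinsB
  alice : X → CoinsA → AliceStrategy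
  bob : Y → CoinsB → BobStrategy
  outA : X → CoinsA → List AliceObs → Bool
  outB : Y → CoinsB → List BobObs → Bool

namespace OTProtocol

variable {X Y : Type*}

/-- The number of oblivious transfer calls. -/
def calls (P : OTProtocol X Y) : ℕ := P.schedule.count Step.ot

/-- Law of the exclusive or of the two final outputs when both players are honest. -/
noncomputable def parityLaw (P : OTProtocol X Y) (x : X) (y : Y) : PMF Bool :=
  P.lawA.bind fun r => P.lawB.map fun s =>
    xor (P.outA x r (runViews P.schedule (P.alice x r) (P.bob y s)).1)
      (P.outB y s (runViews P.schedule (P.alice x r) (P.bob y s)).2)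

/-- On every pair of inputs, the outputs `a, b` of the honest players satisfy `a ⊕ b = f(x, y)`
with probability at least `1 - ε` over the private coins. -/
def ComputesInParity (P : OTProtocol X Y) (f : X → Y → Bool) (ε : ℝ) : Prop :=
  ∀ x y, 1 - ε ≤ (P.parityLaw x y (f x y)).toReal

/-- Law of the view (own coins and all observations) of a malicious Alice, who plays the arbitrary
randomized strategy `A` with coins of law `γ` against the honest Bob with input `y`. -/
noncomputable def maliciousAliceView (P : OTProtocol X Y) {C : Type} (γ : PMF C)
    (A : C → AliceStrategy) (y : Y) : PMF (C × List AliceObs) :=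
  γ.bind fun c => P.lawB.map fun s => (c, (runViews P.schedule (A c) (P.bob y s)).1)

/-- Law of the view of a malicious Bob, who plays the arbitrary randomized strategy `B` with coins
of law `γ` against the honest Alice with input `x`. -/
noncomputable def maliciousBobView (P : OTProtocol X Y) {C : Type} (γ : PMF C)
    (B : C → BobStrategy) (x : X) : PMF (C × List BobObs) :=
  γ.bind fun c => P.lawA.map fun r => (c, (runViews P.schedule (P.alice x r) (B c)).2)

/-- Perfect privacy in the malicious model: whatever a player does, the law of this player's view
does not depend on the input of the other player. -/
def PerfectlyPrivate (P : OTProtocol X Y) : Prop :=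
  (∀ (C : Type) (γ : PMF C) (A : C → AliceStrategy) (y y' : Y),
    P.maliciousAliceView γ A y = P.maliciousAliceView γ A y') ∧
  (∀ (C : Type) (γ : PMF C) (B : C → BobStrategy) (x x' : X),
    P.maliciousBobView γ B x = P.maliciousBobView γ B x')

end OTProtocol

/-- The number of 2-1 oblivious transfer calls required to compute `f` in parity with perfect
privacy in the malicious model and error `ε` (`⊤` if there is no protocol). -/
noncomputable def otComplexity {X Y : Type*} (f : X → Y → Bool) (ε : ℝ) : ℕ∞ :=
  ⨅ (P : OTProtocol X Y) (_ : P.PerfectlyPrivate) (_ : P.ComputesInParity f ε), (P.calls : ℕ∞)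

end SecureEval

namespace SecureEval

/-! ### Discrete laws -/

/-! One oblivious transfer simulates one non-local box. Alice draws a fresh uniform bit `a` as her
box output and enters `(a, a ⊕ p)`; Bob receives `a ⊕ (p ∧ q)`. Alice also samples the shared string
and sends it to Bob. The common order of the boxes lets both players choose the inputs of each call
from earlier outputs. Correctness is `map_otOutputs_simAlice_simBob`. Alice observes nothing. Bob's
side is `map_runViews_simAlice_eq`: the message does not depend on `x`, and each transfer gives him
a bit masked by a fresh coin, whatever he enters. `exists_map_bitString_eq` makes the shared string
sendable. -/

theorem pmf_bind_congr {α β : Type*} (p : PMF α) {f g : α → PMF β}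
    (h : ∀ a ∈ p.support, f a = g a) : p.bind f = p.bind g := by
  ext b
  simp only [PMF.bind_apply]
  refine tsum_congr fun a => ?_
  by_cases ha : p a = 0
  · simp [ha]
  · rw [h a ((PMF.mem_support_iff p a).2 ha)]

/-- Every discrete law is the image of a law on finite bit strings. -/
theorem exists_map_bitString_eq {S : Type*} (p : PMF S) :
    ∃ (dec : List Bool → S) (q : PMF (List Bool)), q.map dec = p := by
  obtain ⟨f, hf⟩ := Set.countable_iff_exists_injOn.1 p.support_countable
  have : Nonempty S := p.support_nonempty.to_type
  -- Unary code: `s` becomes a string of length `f s`. Decoding is correct only on the support,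
  -- where `f` is injective.
  refine ⟨fun l => Function.invFunOn f p.support l.length,
    p.map fun s => List.replicate (f s) true, ?_⟩
  rw [PMF.map_comp]
  conv_rhs => rw [← PMF.bind_pure p]
  refine pmf_bind_congr p fun s hs => ?_
  simp [hf.leftInvOn_invFunOn hs]

/-- Exclusive or with a fixed bit preserves the uniform law. -/
theorem uniform_map_xor {β : Type*} (c : Bool) (F : Bool → β) :
    ((PMF.uniformOfFintype Bool).map fun a => F (xor a c)) =
      (PMF.uniformOfFintype Bool).map F := by
  have h : (PMF.uniformOfFintype Bool).map (fun a => xor a c) = PMF.uniformOfFintype Bool := by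
    ext b
    rw [PMF.map_apply, tsum_bool]
    cases b <;> cases c <;> simp
  conv_rhs => rw [← h, PMF.map_comp]
  rfl

/-- The law of `k` independent uniform bits. -/
noncomputable def coinLaw : ℕ → PMF (List Bool)
  | 0 => PMF.pure []
  | k + 1 => (coinLaw k).bind fun r => (PMF.uniformOfFintype Bool).map fun a => r ++ [a]

theorem length_of_mem_support_coinLaw {k : ℕ} {r : List Bool}
    (hr : r ∈ (coinLaw k).support) : r.length = k := by
  induction k generalizing r with
  | zero => simp_all [coinLaw]
  | succ k ih =>
    simp only [coinLaw, PMF.mem_support_bind_iff, PMF.mem_support_map_iff] at hr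
    obtain ⟨l, hl, a, -, rfl⟩ := hr
    simp [ih hl]

/-! ### Runs in which Alice sends one message, followed by oblivious transfers -/

/-- Alice sends one message, after which the players call `k` oblivious transfers. -/
def sendThenOT (k : ℕ) : List Step := .aliceSends :: List.replicate k .ot

theorem count_ot_sendThenOT (k : ℕ) : (sendThenOT k).count .ot = k := by
  simp [sendThenOT]

theorem runViews_sendThenOT_zero (A : AliceStrategy) (B : BobStrategy) :
    runViews (sendThenOT 0) A B = ([.nothing], [.message (A.msg [])]) := rfl

theorem runViews_sendThenOT_succ (k : ℕ) (A : AliceStrategy) (B : BobStrategy) :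
    runViews (sendThenOT (k + 1)) A B =
      stepViews A B (runViews (sendThenOT k) A B) .ot := by
  have h : sendThenOT (k + 1) = sendThenOT k ++ [.ot] := by
    simp [sendThenOT, List.replicate_succ']
  rw [h, runViews, List.foldl_append]
  rfl

/-- Neither sending nor transferring returns anything to Alice, so even a malicious Alice learns
nothing. -/
theorem runViews_sendThenOT_fst (k : ℕ) (A : AliceStrategy) (B : BobStrategy) :
    (runViews (sendThenOT k) A B).1 = List.replicate (k + 1) .nothing := by
  induction k with
  | zero => rfl
  | succ k ih =>
    rw [runViews_sendThenOT_succ, List.replicate_succ', ← ih]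
    rfl

theorem runViews_sendThenOT_succ_snd (k : ℕ) (A : AliceStrategy) (B : BobStrategy) :
    (runViews (sendThenOT (k + 1)) A B).2 = (runViews (sendThenOT k) A B).2 ++
      [.otOutput (otBox (A.otIn (List.replicate (k + 1) .nothing))
        (B.otIn (runViews (sendThenOT k) A B).2))] := by
  rw [runViews_sendThenOT_succ, ← runViews_sendThenOT_fst k A B]
  rfl

theorem runViews_sendThenOT_congr {k : ℕ} {A A' : AliceStrategy} (B : BobStrategy)
    (hmsg : A.msg [] = A'.msg [])
    (hot : ∀ i < k, A.otIn (List.replicate (i + 1) .nothing) =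
      A'.otIn (List.replicate (i + 1) .nothing)) :
    (runViews (sendThenOT k) A B).2 = (runViews (sendThenOT k) A' B).2 := by
  induction k with
  | zero => simp [runViews_sendThenOT_zero, hmsg]
  | succ k ih =>
    rw [runViews_sendThenOT_succ_snd, runViews_sendThenOT_succ_snd,
      ih fun i hi => hot i (hi.trans k.lt_succ_self), hot k k.lt_succ_self]

/-- The message in Bob's first observation. -/
def firstMessage : List BobObs → List Bool
  | .message m :: _ => m
  | _ => []

/-- The outputs that Bob received from the oblivious transfers. -/
def otOutputs (v : List BobObs) : List Bool :=
  v.filterMap fun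
    | .otOutput b => some b
    | _ => none

theorem otOutputs_append_otOutput (v : List BobObs) (b : Bool) :
    otOutputs (v ++ [.otOutput b]) = otOutputs v ++ [b] := by
  simp [otOutputs]

theorem firstMessage_runViews_sendThenOT (k : ℕ) (A : AliceStrategy) (B : BobStrategy) :
    firstMessage (runViews (sendThenOT k) A B).2 = A.msg [] := by
  have h : ∃ w, (runViews (sendThenOT k) A B).2 = .message (A.msg []) :: w := by
    induction k with
    | zero => exact ⟨[], rfl⟩
    | succ k ih =>
      obtain ⟨w, hw⟩ := ih
      rw [runViews_sendThenOT_succ_snd, hw]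
      exact ⟨_, rfl⟩
  obtain ⟨w, hw⟩ := h
  rw [hw, firstMessage]

theorem otBox_masked (a p q : Bool) : otBox (a, xor a p) q = xor a (p && q) := by
  cases q <;> simp [otBox]

/-! ### Simulating non-local boxes -/

namespace OrdNLProtocol

variable {X Y : Type*} (P : OrdNLProtocol X Y) (dec : List Bool → P.Shared)

/-- Alice sends `m`, which encodes the shared random string. She replaces box `i` by an oblivious
transfer on `(a, a ⊕ p)`, where `p` is her input to the box and the coin `a = r[i]` stands for her
output from it. -/
def simAlice (x : X) (m r : List Bool) : AliceStrategy where
  msg _ := m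
  -- Alice's first observation belongs to the sending step, so `v.length - 1` counts the earlier
  -- transfers. The default `false` is not reached when `r` has one coin per transfer.
  otIn v := (r.getD (v.length - 1) false, xor (r.getD (v.length - 1) false)
    (P.inA x (dec m) (r.take (v.length - 1))))

/-- Bob decodes the shared random string and uses the output of an oblivious transfer as his output
from the box. -/
def simBob (y : Y) : BobStrategy where
  msg _ := []
  otIn v := P.inB y (dec (firstMessage v)) (otOutputs v)

/-- Each transfer reads only its own coin and the earlier ones, so a later coin is still fresh. -/
theorem runViews_simAlice_append (x : X) (m r : List Bool) (a : Bool) (B : BobStrategy) :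
    (runViews (sendThenOT r.length) (P.simAlice dec x m (r ++ [a])) B).2 =
      (runViews (sendThenOT r.length) (P.simAlice dec x m r) B).2 := by
  refine runViews_sendThenOT_congr B rfl fun i hi => ?_
  simp [simAlice, List.getElem?_append_left hi, List.take_append_of_le_length hi.le]

theorem runViews_simAlice_succ (x : X) (m r : List Bool) (a : Bool) (B : BobStrategy) :
    (runViews (sendThenOT (r.length + 1)) (P.simAlice dec x m (r ++ [a])) B).2 =
      (runViews (sendThenOT r.length) (P.simAlice dec x m r) B).2 ++
        [.otOutput (xor a (P.inA x (dec m) r &&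
          B.otIn (runViews (sendThenOT r.length) (P.simAlice dec x m r) B).2))] := by
  rw [runViews_sendThenOT_succ_snd, runViews_simAlice_append, ← otBox_masked]
  simp [simAlice]

/-- Whatever Bob does, the law of his observations against the simulating Alice does not depend on
her input: the oblivious transfers give him independent uniform bits. -/
theorem map_runViews_simAlice_eq (x x' : X) (m : List Bool) (B : BobStrategy) (k : ℕ) :
    ((coinLaw k).map fun r => (runViews (sendThenOT k) (P.simAlice dec x m r) B).2) =
      (coinLaw k).map fun r => (runViews (sendThenOT k) (P.simAlice dec x' m r) B).2 := by
  have step : ∀ (k : ℕ) (z : X),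
      ((coinLaw (k + 1)).map fun r =>
          (runViews (sendThenOT (k + 1)) (P.simAlice dec z m r) B).2) =
        ((coinLaw k).map fun r => (runViews (sendThenOT k) (P.simAlice dec z m r) B).2).bind
          fun v => (PMF.uniformOfFintype Bool).map fun a => v ++ [.otOutput a] := by
    intro k z
    rw [coinLaw, PMF.map_bind, PMF.bind_map]
    refine pmf_bind_congr _ fun r hr => ?_
    -- The new coin must sit at index `k`, which is where transfer `k + 1` reads it.
    obtain rfl := length_of_mem_support_coinLaw hr
    rw [PMF.map_comp]
    simp only [Function.comp_def, runViews_simAlice_succ]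
    -- Given `r`, the bit `p ∧ q` is fixed before the new coin is drawn, so the coin hides it.
    exact uniform_map_xor _ fun b =>
      (runViews (sendThenOT r.length) (P.simAlice dec z m r) B).2 ++ [.otOutput b]
  induction k with
  | zero => rfl
  | succ k ih => rw [step, step, ih]

/-- Alice's coins together with Bob's outputs from the oblivious transfers are distributed as the
outputs of the non-local boxes. -/
theorem map_otOutputs_simAlice_simBob (x : X) (y : Y) (m : List Bool) (k : ℕ) :
    ((coinLaw k).map fun r =>
        (r, otOutputs (runViews (sendThenOT k) (P.simAlice dec x m r) (P.simBob dec y)).2)) =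
      P.boxOutputs x y (dec m) k := by
  induction k with
  | zero => simp [coinLaw, boxOutputs, PMF.pure_map, runViews_sendThenOT_zero, otOutputs]
  | succ k ih =>
    rw [boxOutputs, ← ih, coinLaw, PMF.map_bind, PMF.bind_map]
    refine pmf_bind_congr _ fun r hr => ?_
    obtain rfl := length_of_mem_support_coinLaw hr
    have hB : (P.simBob dec y).otIn
        (runViews (sendThenOT r.length) (P.simAlice dec x m r) (P.simBob dec y)).2 =
        P.inB y (dec m) (otOutputs
          (runViews (sendThenOT r.length) (P.simAlice dec x m r) (P.simBob dec y)).2) := by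
      change P.inB y (dec (firstMessage _)) _ = _
      rw [firstMessage_runViews_sendThenOT]
      rfl
    simp only [nlBox, PMF.map_comp, Function.comp_def, runViews_simAlice_succ,
      otOutputs_append_otOutput, hB]

/-- The protocol with oblivious transfer that simulates `P`, when the shared random string is
decoded from a bit string of law `q`. -/
noncomputable def toOTProtocol (q : PMF (List Bool)) : OTProtocol X Y where
  schedule := sendThenOT P.boxes
  CoinsA := List Bool × List Bool
  CoinsB := Unit
  lawA := q.bind fun m => (coinLaw P.boxes).map fun r => (m, r)
  lawB := PMF.pure ()
  alice x c := P.simAlice dec x c.1 c.2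
  bob y _ := P.simBob dec y
  outA x c _ := P.outA x (dec c.1) c.2
  outB y _ v := P.outB y (dec (firstMessage v)) (otOutputs v)

theorem calls_toOTProtocol (q : PMF (List Bool)) : (P.toOTProtocol dec q).calls = P.boxes :=
  count_ot_sendThenOT P.boxes

theorem perfectlyPrivate_toOTProtocol (q : PMF (List Bool)) :
    (P.toOTProtocol dec q).PerfectlyPrivate := by
  refine ⟨fun C γ A y y' => ?_, fun C γ B x x' => ?_⟩
  · simp only [OTProtocol.maliciousAliceView, toOTProtocol, runViews_sendThenOT_fst]
  · simp only [OTProtocol.maliciousBobView, toOTProtocol, PMF.map_bind, PMF.map_comp,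
      Function.comp_def]
    congr 1
    funext c
    congr 1
    funext m
    -- With Bob's coins `c` and the message `m` fixed, only the transfer coins remain random.
    have h := congrArg (PMF.map (Prod.mk c))
      (P.map_runViews_simAlice_eq dec x x' m (B c) P.boxes)
    simpa only [PMF.map_comp, Function.comp_def] using h

theorem parityLaw_toOTProtocol {q : PMF (List Bool)} (hq : q.map dec = P.law) (x : X) (y : Y) :
    (P.toOTProtocol dec q).parityLaw x y = P.parityLaw x y := by
  rw [parityLaw, ← hq, PMF.bind_map]
  simp only [OTProtocol.parityLaw, toOTProtocol, PMF.bind_bind, PMF.bind_map, PMF.pure_map,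
    Function.comp_def, firstMessage_runViews_sendThenOT]
  congr 1
  funext m
  rw [← map_otOutputs_simAlice_simBob, PMF.map_comp]
  rfl

end OrdNLProtocol

end SecureEval

theorem mainTheorem5 {X Y : Type*} (f : X → Y → Bool) (ε : ℝ) (hε : 0 ≤ ε) :
    SecureEval.otComplexity f ε ≤ SecureEval.ordNLComplexity f ε := by
  refine le_iInf₂ fun P hP => ?_
  obtain ⟨dec, q, hq⟩ := SecureEval.exists_map_bitString_eq P.law
  refine (iInf₂_le_of_le (P.toOTProtocol dec q) (P.perfectlyPrivate_toOTProtocol dec q)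
    (iInf_le_of_le (fun x y => ?_) (le_of_eq ?_)))
  · rw [P.parityLaw_toOTProtocol dec hq]
    exact hP x y
  · rw [P.calls_toOTProtocol]
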